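/- Let $k\ge 1$ be an integer and let $\alpha_0,\dots,\alpha_k\ge 0$ be real numbers, where the case $k=1$, $\alpha_0=\alpha_1=0$ is excluded. Put $$\mu:=\alpha_0+\cdots+\alpha_k+\frac{k-1}{2},\qquad h(\mathbf{x}):=\prod_{j=0}^k|x_j|^{\alpha_j}\quad(\mathbf{x}\in\mathbb{R}^{k+1}).$$ For a real polynomial $u$ in $\mathbf{x}=(x_0,\dots,x_k)$ let $$\mathcal{D}_j u(\mathbf{x}):=\frac{\partial u(\mathbf{x})}{\partial x_j}+\alpha_j\,\frac{u(\mathbf{x})-u(\sigma_j\mathbf{x})}{x_j},\qquad \Delta_h:=\mathcal{D}_0^2+\cdots+\mathcal{D}_k^2,$$ where $\sigma_j$ is the reflection at the $j$th coordinate plane (the quotient is again a polynomial). A spherical $h$-harmonic of degree $m$ is a homogeneous polynomial $Y$ of degree $m$ with $\Delta_h Y=0$, and $Y(\mathcal{D}):=Y(\mathcal{D}_0,\dots,\mathcal{D}_k)$. Let $\mathbf{S}^k$ be the unit sphere of $\mathbb{R}^{k+1}$ with its standard surface measure $d\mathbf{S}$. Let $f_\ell$ ($\ell=0,1,2,\dots$)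 be homogeneous real polynomials of degree $\ell$ such that $\sum_{\ell=0}^\infty f_\ell(\mathbf{x})$ converges (in the sense of partial sums) uniformly on $\mathbf{S}^k$ to a function $f(\mathbf{x})$, and let $Y$ be a spherical $h$-harmonic of degree $m\ge 0$. Then $h^2fY$ is integrable over $\mathbf{S}^k$ and $$\int_{\mathbf{S}^k}h^2(\mathbf{x})f(\mathbf{x})Y(\mathbf{x})\,d\mathbf{S}(\mathbf{x})=\sum_{r=0}^\infty\frac{1}{2^{m+2r-1}\,r!}\,\frac{\prod_{i=0}^k\Gamma(\alpha_i+\frac12)}{\Gamma(m+\mu+r+1)}\,\Delta_h^r\,Y(\mathcal{D})f_{m+2r}(\mathbf{z})$$ for every $\mathbf{z}\in\mathbb{R}^{k+1}$, where the series converges as the limit of its partial sums (each $\Delta_h^rY(\mathcal{D})f_{m+2r}$ is a constant polynomial, so the right-hand side does not depend on $\mathbf{z}$). -/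

import Mathlib

open MeasureTheory Filter Topology MvPolynomial

noncomputable section

/-- The action of the reflection `σ_j` at the `j`th coordinate plane on polynomials in
`x_0, …, x_k`: `p(x) ↦ p(σ_j x)`, i.e. substitute `-x_j` for `x_j`. -/
def polyReflect {k : ℕ} (j : Fin (k + 1)) :
    MvPolynomial (Fin (k + 1)) ℝ →ₐ[ℝ] MvPolynomial (Fin (k + 1)) ℝ :=
  aeval fun i => if i = j then -X i else X i

/-- The polynomial `p - p ∘ σ_j` is divisible by `x_j`. -/
theorem X_dvd_sub_polyReflect {k : ℕ} (j : Fin (k + 1)) (p : MvPolynomial (Fin (k + 1)) ℝ) :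
    X j ∣ p - polyReflect j p := by
  induction p using MvPolynomial.induction_on with
  | C a => simp [polyReflect]
  | add p q hp hq =>
    have h : p + q - polyReflect j (p + q) =
        (p - polyReflect j p) + (q - polyReflect j q) := by rw [map_add]; ring
    rw [h]; exact dvd_add hp hq
  | mul_X p i hp =>
    have h : p * X i - polyReflect j (p * X i) =
        (p - polyReflect j p) * X i + polyReflect j p * (X i - polyReflect j (X i)) := by
      rw [map_mul]; ring
    rw [h]
    refine dvd_add (hp.mul_right _) (Dvd.dvd.mul_left ?_ _)
    by_cases hij : i = j
    · subst hij
      exact ⟨2, by simp [polyReflect]; ring⟩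
    · simp [polyReflect, hij]

/-- The polynomial quotient `(p(x) - p(σ_j x)) / x_j`. -/
def dunklQuotient {k : ℕ} (j : Fin (k + 1)) (p : MvPolynomial (Fin (k + 1)) ℝ) :
    MvPolynomial (Fin (k + 1)) ℝ :=
  (p - polyReflect j p).divMonomial (Finsupp.single j 1)

/-- The division in `dunklQuotient` is exact. -/
theorem X_mul_dunklQuotient {k : ℕ} (j : Fin (k + 1)) (p : MvPolynomial (Fin (k + 1)) ℝ) :
    X j * dunklQuotient j p = p - polyReflect j p := by
  obtain ⟨q, hq⟩ := X_dvd_sub_polyReflect j p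
  rw [dunklQuotient, hq, X_mul_divMonomial]

/-- The Dunkl operator `𝒟_j u(x) = ∂u(x)/∂x_j + α_j (u(x) - u(σ_j x)) / x_j`
as a linear operator on polynomials. -/
def dunklOp {k : ℕ} (α : Fin (k + 1) → ℝ) (j : Fin (k + 1)) :
    Module.End ℝ (MvPolynomial (Fin (k + 1)) ℝ) where
  toFun p := pderiv j p + α j • dunklQuotient j p
  map_add' p q := by
    have h : dunklQuotient j (p + q) = dunklQuotient j p + dunklQuotient j q := by
      apply mul_left_cancel₀ (X_ne_zero (R := ℝ) j)
      rw [mul_add, X_mul_dunklQuotient, X_mul_dunklQuotient, X_mul_dunklQuotient, map_add]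
      ring
    rw [h, map_add, smul_add]
    abel
  map_smul' c p := by
    have h : dunklQuotient j (c • p) = c • dunklQuotient j p := by
      apply mul_left_cancel₀ (X_ne_zero (R := ℝ) j)
      rw [mul_smul_comm, X_mul_dunklQuotient, X_mul_dunklQuotient, map_smul, smul_sub]
    rw [h, Derivation.map_smul, RingHom.id_apply, smul_add, smul_comm]

/-- Pointwise form of the Dunkl operator, away from the hyperplane `x_j = 0`. -/
theorem eval_dunklOp {k : ℕ} (α : Fin (k + 1) → ℝ) (j : Fin (k + 1))
    (p : MvPolynomial (Fin (k + 1)) ℝ) (x : Fin (k + 1) → ℝ) (hx : x j ≠ 0) :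
    eval x (dunklOp α j p) = eval x (pderiv j p) +
      α j * ((eval x p - eval (fun i => if i = j then -x i else x i) p) / x j) := by
  have h1 : eval x (polyReflect j p) = eval (fun i => if i = j then -x i else x i) p := by
    rw [polyReflect, aeval_def, eval₂_eq_eval_map, ← eval₂_eq_eval_map]
    rw [← coe_eval₂Hom, ← RingHom.comp_apply]
    congr 1
    ext i
    · simp
    · by_cases hij : i = j <;> simp [hij]
  have h2 := congrArg (eval x) (X_mul_dunklQuotient j p)
  rw [map_mul, map_sub, eval_X, h1] at h2
  have h3 : eval x (dunklQuotient j p) =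
      (eval x p - eval (fun i => if i = j then -x i else x i) p) / x j := by
    rw [← h2, mul_div_cancel_left₀ _ hx]
  change eval x (pderiv j p + α j • dunklQuotient j p) = _
  rw [map_add, smul_eval, h3]

/-- The Dunkl–Laplacian `Δ_h = 𝒟_0² + ⋯ + 𝒟_k²` on polynomials. -/
def dunklLaplacian {k : ℕ} (α : Fin (k + 1) → ℝ) :
    Module.End ℝ (MvPolynomial (Fin (k + 1)) ℝ) :=
  ∑ j, dunklOp α j ^ 2

/-- `Y(𝒟) = Y(𝒟_0, …, 𝒟_k) = ∑_q c_q 𝒟_0^{q_0} ⋯ 𝒟_k^{q_k}` for a polynomial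
`Y = ∑_q c_q x_0^{q_0} ⋯ x_k^{q_k}` (the order of the factors is immaterial, because the
operators `𝒟_j` commute). -/
def dunklPolyOp {k : ℕ} (α : Fin (k + 1) → ℝ) (Y : MvPolynomial (Fin (k + 1)) ℝ) :
    Module.End ℝ (MvPolynomial (Fin (k + 1)) ℝ) :=
  ∑ q ∈ Y.support, Y.coeff q • (List.ofFn fun j => dunklOp α j ^ q j).prod

/-- A spherical `h`-harmonic of degree `m`: an `h`-harmonic homogeneous polynomial of
degree `m`. -/
structure IsSphericalHHarmonic {k : ℕ} (α : Fin (k + 1) → ℝ) (m : ℕ)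
    (Y : MvPolynomial (Fin (k + 1)) ℝ) : Prop where
  isHomogeneous : Y.IsHomogeneous m
  dunklLaplacian_eq_zero : dunklLaplacian α Y = 0

/-- The weight `h(x) = |x_0|^{α_0} ⋯ |x_k|^{α_k}`. -/
def dunklWeight {k : ℕ} (α : Fin (k + 1) → ℝ) (x : EuclideanSpace ℝ (Fin (k + 1))) : ℝ :=
  ∏ j, |x j| ^ α j

/-- The constant `μ = α_0 + ⋯ + α_k + (k - 1)/2`. -/
def dunklMu {k : ℕ} (α : Fin (k + 1) → ℝ) : ℝ :=
  (∑ j, α j) + ((k : ℝ) - 1) / 2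

end

/-!
Integration over the sphere is compared with integration against the weighted Gaussian. Let
`L p = ∫ h² p e^(-|x|²/2) dx`, taken over the whole space (`gaussFunctional`,
`gaussFunctional_eq_integral`). In polar coordinates `L p` is, for homogeneous `p`, the integral of
`h² p` over the sphere times an explicit power of two and a value of the Gamma function
(`gaussFunctional_eq_toSphere`).

For `L` the operators `𝒟_j` can be integrated by parts: the adjoint of `𝒟_j` is `x_j - 𝒟_j`
(`gaussFunctional_X_mul_mul`). The relation `[Δ_h, x_j] = 2 𝒟_j` says that conjugation by
`e^{-Δ_h/2}` takes multiplication by `x_j` to `x_j - 𝒟_j` (`heatSum_X_mul`), so that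
`L (Y(𝒟) p) = L (p · e^{-Δ_h/2} Y)` (`gaussFunctional_dunklPolyOp`), which is `L (p Y)` if `Y` is
`h`-harmonic. When `p` is homogeneous of degree `l` and `Y` of degree `m`, the polynomial `Y(𝒟) p`
is homogeneous of degree `l - m`. On homogeneous polynomials of degree `d` one has
`L (Δ_h q) = d · L q` (`gaussFunctional_dunklLaplacian`), whence `L q = 0` for odd `d` and
`L q = Δ_h^r q / (2^r r!) · L 1` for `d = 2r`. This is the formula for one homogeneous polynomial
(`toSphere_integral_mul_harmonic_eq`), and it gives zero unless `l = m + 2r`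
(`toSphere_integral_mul_harmonic_eq_zero`).

All identities for polynomials are verified on monomials, where `𝒟_j` acts by
`x^s ↦ (s_j + α_j (1 - (-1)^{s_j})) x^(s - e_j)` and `L` is a product of moments on the line.
Uniform convergence on the sphere, which has finite measure, allows integration term by term
(`integrable_and_tendsto_integral_of_tendstoUniformly`).
-/

noncomputable section

/-- The Dunkl analogue `n + a (1 - (-1)^n)` of the exponent `n`: it equals `n` for even `n` and
`n + 2a` for odd `n`, and `𝒟_j x^s = dunklNum (α_j) s_j • x^(s - e_j)`. -/
def dunklNum (a : ℝ) (n : ℕ) : ℝ := n + a * (1 - (-1) ^ n)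

@[simp] lemma dunklNum_zero (a : ℝ) : dunklNum a 0 = 0 := by simp [dunklNum]

lemma dunklNum_even (a : ℝ) {n : ℕ} (h : Even n) : dunklNum a n = n := by
  simp [dunklNum, h.neg_one_pow]

lemma dunklNum_odd (a : ℝ) {n : ℕ} (h : Odd n) : dunklNum a n = n + 2 * a := by
  simp only [dunklNum, h.neg_one_pow]; ring

lemma dunklNum_add_two (a : ℝ) (n : ℕ) : dunklNum a (n + 2) = dunklNum a n + 2 := by
  simp only [dunklNum, pow_add]; push_cast; ring

variable {k : ℕ}

/-! ### Dunkl operators on monomials and their commutation relations -/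

lemma X_mul_monomial_sub_single (j : Fin (k + 1)) (s : Fin (k + 1) →₀ ℕ) (c : ℝ)
    (h : s j = 0 → c = 0) :
    X j * monomial (s - Finsupp.single j 1) c = monomial s c := by
  by_cases hs : s j = 0
  · simp [h hs]
  · rw [X, monomial_mul, one_mul, add_tsub_cancel_of_le]
    simpa [Nat.one_le_iff_ne_zero] using hs

lemma polyReflect_monomial (j : Fin (k + 1)) (s : Fin (k + 1) →₀ ℕ) (c : ℝ) :
    polyReflect j (monomial s c) = monomial s (c * (-1) ^ s j) := by
  rw [polyReflect, aeval_monomial, Finsupp.prod_fintype _ _ (by simp)]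
  have h : ∀ i, (if i = j then -X i else X i : MvPolynomial (Fin (k + 1)) ℝ) ^ s i =
      (if i = j then (-1) ^ s i else 1) * X i ^ s i := by
    intro i; split_ifs
    · rw [neg_pow]
    · rw [one_mul]
  simp_rw [h]
  rw [Finset.prod_mul_distrib, Finset.prod_ite_eq' Finset.univ j, if_pos (Finset.mem_univ j),
    monomial_eq, Finsupp.prod_fintype _ _ (by simp), C_mul, C_pow, C_neg, C_1, algebraMap_eq]
  ring

lemma dunklQuotient_monomial (j : Fin (k + 1)) (s : Fin (k + 1) →₀ ℕ) (c : ℝ) :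
    dunklQuotient j (monomial s c) =
      monomial (s - Finsupp.single j 1) (c * (1 - (-1) ^ s j)) := by
  apply mul_left_cancel₀ (X_ne_zero (R := ℝ) j)
  rw [X_mul_dunklQuotient, polyReflect_monomial, X_mul_monomial_sub_single, ← map_sub]
  · congr 1; ring
  · intro h; simp [h]

lemma dunklOp_monomial (α : Fin (k + 1) → ℝ) (j : Fin (k + 1)) (s : Fin (k + 1) →₀ ℕ) (c : ℝ) :
    dunklOp α j (monomial s c) =
      monomial (s - Finsupp.single j 1) (c * dunklNum (α j) (s j)) := by
  change pderiv j _ + α j • dunklQuotient j _ = _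
  rw [pderiv_monomial, dunklQuotient_monomial, smul_monomial, ← map_add]
  congr 1
  simp only [dunklNum, smul_eq_mul]; ring

lemma X_mul_dunklOp_monomial (α : Fin (k + 1) → ℝ) (j : Fin (k + 1)) (s : Fin (k + 1) →₀ ℕ)
    (c : ℝ) :
    X j * dunklOp α j (monomial s c) = monomial s (c * dunklNum (α j) (s j)) := by
  rw [dunklOp_monomial, X_mul_monomial_sub_single]
  intro h; simp [h]

lemma dunklOp_comm (α : Fin (k + 1) → ℝ) (i j : Fin (k + 1)) :
    Commute (dunklOp α i) (dunklOp α j) := by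
  rcases eq_or_ne i j with rfl | hij
  · exact Commute.refl _
  refine LinearMap.ext fun p => ?_
  change dunklOp α i (dunklOp α j p) = dunklOp α j (dunklOp α i p)
  induction p using MvPolynomial.induction_on' with
  | monomial s c =>
    simp only [dunklOp_monomial, tsub_right_comm (a := s) (b := Finsupp.single j 1), Finsupp.tsub_apply,
      Finsupp.single_eq_of_ne hij, Finsupp.single_eq_of_ne hij.symm, tsub_zero]
    congr 1; ring
  | add p q hp hq => simp only [map_add, hp, hq]

lemma dunklOp_X_mul_of_ne (α : Fin (k + 1) → ℝ) {i j : Fin (k + 1)} (hij : i ≠ j)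
    (p : MvPolynomial (Fin (k + 1)) ℝ) :
    dunklOp α i (X j * p) = X j * dunklOp α i p := by
  induction p using MvPolynomial.induction_on' with
  | monomial s c =>
    have hs : Finsupp.single j 1 + s - Finsupp.single i 1 =
        Finsupp.single j 1 + (s - Finsupp.single i 1) := by
      ext l
      by_cases hl : l = i
      · subst hl; simp [Finsupp.single_eq_of_ne hij]
      · simp [Finsupp.single_eq_of_ne hl]
    simp only [X, monomial_mul, dunklOp_monomial, one_mul, hs, Finsupp.add_apply,
      Finsupp.single_eq_of_ne hij, zero_add]
  | add p q hp hq => simp only [mul_add, map_add, hp, hq]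

lemma dunklOp_dunklOp_X_mul (α : Fin (k + 1) → ℝ) (j : Fin (k + 1))
    (p : MvPolynomial (Fin (k + 1)) ℝ) :
    dunklOp α j (dunklOp α j (X j * p)) =
      X j * dunklOp α j (dunklOp α j p) + (2 : ℝ) • dunklOp α j p := by
  induction p using MvPolynomial.induction_on' with
  | monomial s c =>
    rw [X, monomial_mul, one_mul, dunklOp_monomial, add_tsub_cancel_left, dunklOp_monomial,
      ← X, dunklOp_monomial α j s, X_mul_dunklOp_monomial, smul_monomial, ← map_add]
    congr 1
    rcases hs : s j with _ | n
    · simp [hs]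
    · have h1 : 1 + (n + 1) = n + 2 := by ring
      simp only [Finsupp.add_apply, Finsupp.single_eq_same, Finsupp.tsub_apply, hs, h1,
        dunklNum_add_two, smul_eq_mul, Nat.add_sub_cancel]
      ring
  | add p q hp hq => simp only [mul_add, map_add, hp, hq, smul_add]; abel

lemma dunklLaplacian_apply (α : Fin (k + 1) → ℝ) (p : MvPolynomial (Fin (k + 1)) ℝ) :
    dunklLaplacian α p = ∑ j, dunklOp α j (dunklOp α j p) := by
  simp [dunklLaplacian, LinearMap.sum_apply, pow_two]

lemma dunklLaplacian_comm_dunklOp (α : Fin (k + 1) → ℝ) (j : Fin (k + 1)) :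
    Commute (dunklLaplacian α) (dunklOp α j) :=
  Commute.sum_left _ _ _ fun i _ => (dunklOp_comm α i j).pow_left 2

/-- The commutation relation `[Δ_h, x_j] = 2 𝒟_j`. -/
lemma dunklLaplacian_X_mul (α : Fin (k + 1) → ℝ) (j : Fin (k + 1))
    (p : MvPolynomial (Fin (k + 1)) ℝ) :
    dunklLaplacian α (X j * p) = X j * dunklLaplacian α p + (2 : ℝ) • dunklOp α j p := by
  rw [dunklLaplacian_apply, dunklLaplacian_apply, Finset.mul_sum,
    ← Finset.add_sum_erase _ _ (Finset.mem_univ j),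
    ← Finset.add_sum_erase _ (fun i => X j * _) (Finset.mem_univ j), dunklOp_dunklOp_X_mul]
  have h : ∀ i ∈ Finset.univ.erase j, dunklOp α i (dunklOp α i (X j * p)) =
      X j * dunklOp α i (dunklOp α i p) := by
    intro i hi
    rw [dunklOp_X_mul_of_ne α (Finset.ne_of_mem_erase hi),
      dunklOp_X_mul_of_ne α (Finset.ne_of_mem_erase hi)]
  rw [Finset.sum_congr rfl h]
  abel

lemma dunklLaplacian_pow_X_mul (α : Fin (k + 1) → ℝ) (j : Fin (k + 1)) (n : ℕ)
    (p : MvPolynomial (Fin (k + 1)) ℝ) :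
    (dunklLaplacian α ^ (n + 1)) (X j * p) = X j * (dunklLaplacian α ^ (n + 1)) p +
      (2 * (n + 1) : ℝ) • dunklOp α j ((dunklLaplacian α ^ n) p) := by
  induction n with
  | zero => simp [dunklLaplacian_X_mul]
  | succ n ih =>
    have hc : dunklLaplacian α (dunklOp α j ((dunklLaplacian α ^ n) p)) =
        dunklOp α j ((dunklLaplacian α ^ (n + 1)) p) := by
      rw [pow_succ' _ n]
      exact LinearMap.congr_fun (dunklLaplacian_comm_dunklOp α j) _
    rw [pow_succ' _ (n + 1), Module.End.mul_apply, ih, map_add, dunklLaplacian_X_mul, map_smul,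
      hc, Module.End.mul_apply, add_assoc, ← add_smul]
    congr 2
    push_cast; ring

/-! ### The heat operator `e^{-Δ_h/2}` -/

/-- The partial sum of order `N` of `e^{-Δ_h/2} = ∑ (-1/2)^n Δ_h^n / n!`. -/
def heatSum (α : Fin (k + 1) → ℝ) (N : ℕ) : Module.End ℝ (MvPolynomial (Fin (k + 1)) ℝ) :=
  ∑ n ∈ Finset.range N, ((-1 / 2 : ℝ) ^ n / n.factorial) • dunklLaplacian α ^ n

/-- The truncated form of `e^{-Δ_h/2} x_j = (x_j - 𝒟_j) e^{-Δ_h/2}`. -/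
lemma heatSum_X_mul (α : Fin (k + 1) → ℝ) (N : ℕ) (j : Fin (k + 1))
    (p : MvPolynomial (Fin (k + 1)) ℝ) :
    heatSum α (N + 1) (X j * p) =
      X j * heatSum α (N + 1) p - dunklOp α j (heatSum α N p) := by
  simp only [heatSum, LinearMap.sum_apply, LinearMap.smul_apply, map_sum, map_smul]
  rw [Finset.sum_range_succ', Finset.sum_range_succ', mul_add, Finset.mul_sum,
    add_sub_right_comm, ← Finset.sum_sub_distrib]
  congr 1
  · refine Finset.sum_congr rfl fun n _ => ?_
    rw [dunklLaplacian_pow_X_mul, smul_add, smul_smul, mul_smul_comm, sub_eq_add_neg, ← neg_smul]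
    congr 2
    rw [Nat.factorial_succ, pow_succ]
    have : (n.factorial : ℝ) ≠ 0 := by positivity
    push_cast
    field_simp
  · simp

lemma heatSum_of_harmonic (α : Fin (k + 1) → ℝ) (N : ℕ) {p : MvPolynomial (Fin (k + 1)) ℝ}
    (hp : dunklLaplacian α p = 0) : heatSum α (N + 1) p = p := by
  simp only [heatSum, LinearMap.sum_apply, LinearMap.smul_apply]
  rw [Finset.sum_range_succ', Finset.sum_eq_zero]
  · simp
  · intro n _
    rw [pow_succ (dunklLaplacian α), Module.End.mul_apply, hp, map_zero, smul_zero]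

/-! ### The operators `Y(𝒟)` -/

lemma prod_ofFn_pow_add_single {M : Type*} [Monoid M] {n : ℕ} (a : Fin n → M)
    (ha : ∀ i j, Commute (a i) (a j)) (q : Fin n → ℕ) (i : Fin n) :
    (List.ofFn fun j => a j ^ (q j + if i = j then 1 else 0)).prod =
      (List.ofFn fun j => a j ^ q j).prod * a i := by
  induction n with
  | zero => exact i.elim0
  | succ n ih =>
    rw [List.ofFn_succ, List.prod_cons, List.ofFn_succ, List.prod_cons]
    refine Fin.cases ?_ (fun i => ?_) i
    · have hc : Commute (List.ofFn fun j : Fin n => a j.succ ^ q j.succ).prod (a 0) := by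
        refine Commute.list_prod_left _ _ fun x hx => ?_
        obtain ⟨j, rfl⟩ := (List.mem_ofFn' _ _).1 hx
        exact (ha _ _).pow_left _
      have h0 : ∀ j : Fin n, ¬ (0 : Fin (n + 1)) = j.succ := fun j => (Fin.succ_ne_zero j).symm
      simp only [if_true, h0, if_false, add_zero, pow_succ, mul_assoc, hc.eq]
    · have h := ih (fun j => a j.succ) (fun i j => ha _ _) (fun j => q j.succ) i
      simp only [Fin.succ_inj, Fin.succ_ne_zero, if_false, add_zero, mul_assoc]
      rw [h]

lemma dunklPolyOp_eq_sum_of_subset (α : Fin (k + 1) → ℝ) (p : MvPolynomial (Fin (k + 1)) ℝ)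
    {T : Finset (Fin (k + 1) →₀ ℕ)} (hT : p.support ⊆ T) :
    dunklPolyOp α p =
      ∑ q ∈ T, p.coeff q • (List.ofFn fun j => dunklOp α j ^ q j).prod := by
  refine Finset.sum_subset hT fun q _ hq => ?_
  rw [notMem_support_iff.1 hq, zero_smul]

lemma dunklPolyOp_monomial (α : Fin (k + 1) → ℝ) (s : Fin (k + 1) →₀ ℕ) (c : ℝ) :
    dunklPolyOp α (monomial s c) = c • (List.ofFn fun j => dunklOp α j ^ s j).prod := by
  rw [dunklPolyOp_eq_sum_of_subset α _ support_monomial_subset, Finset.sum_singleton,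
    coeff_monomial, if_pos rfl]

lemma dunklPolyOp_add (α : Fin (k + 1) → ℝ) (p q : MvPolynomial (Fin (k + 1)) ℝ) :
    dunklPolyOp α (p + q) = dunklPolyOp α p + dunklPolyOp α q := by
  classical
  rw [dunklPolyOp_eq_sum_of_subset α _ (support_add (p := p) (q := q)),
    dunklPolyOp_eq_sum_of_subset α p (Finset.subset_union_left (s₂ := q.support)),
    dunklPolyOp_eq_sum_of_subset α q (Finset.subset_union_right (s₁ := p.support)),
    ← Finset.sum_add_distrib]
  simp only [coeff_add, add_smul]

lemma dunklPolyOp_C (α : Fin (k + 1) → ℝ) (c : ℝ) :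
    dunklPolyOp α (C c) = c • 1 := by
  rw [C_apply, dunklPolyOp_monomial]
  congr 1
  exact List.prod_eq_one fun x hx => by
    obtain ⟨j, rfl⟩ := (List.mem_ofFn' _ _).1 hx
    simp

lemma dunklPolyOp_mul_X (α : Fin (k + 1) → ℝ) (p : MvPolynomial (Fin (k + 1)) ℝ)
    (i : Fin (k + 1)) : dunklPolyOp α (p * X i) = dunklPolyOp α p * dunklOp α i := by
  induction p using MvPolynomial.induction_on' with
  | monomial s c =>
    rw [X, monomial_mul, mul_one, dunklPolyOp_monomial, dunklPolyOp_monomial, smul_mul_assoc,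
      ← prod_ofFn_pow_add_single _ (dunklOp_comm α)]
    simp only [Finsupp.add_apply, Finsupp.single_apply]
  | add p q hp hq => rw [add_mul, dunklPolyOp_add, hp, hq, dunklPolyOp_add, add_mul]

/-! ### Homogeneous components under the Dunkl operators -/

lemma MvPolynomial.IsHomogeneous.degree_eq_of_mem_support {σ R : Type*} [CommSemiring R]
    {p : MvPolynomial σ R} {d : ℕ} (hp : p.IsHomogeneous d) {s : σ →₀ ℕ} (hs : s ∈ p.support) :
    s.degree = d := by
  rw [← hp (mem_support_iff.1 hs), Finsupp.degree_eq_weight_one]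
  rfl

/-- The submodule of polynomials that are homogeneous of degree `d`, with `d` an integer: it is
trivial for `d < 0`, so that operators lowering the degree need no truncated subtraction. -/
def homogeneousInt (k : ℕ) (d : ℤ) : Submodule ℝ (MvPolynomial (Fin (k + 1)) ℝ) :=
  Submodule.span ℝ {p | ∃ s : Fin (k + 1) →₀ ℕ, (s.degree : ℤ) = d ∧ p = monomial s 1}

lemma monomial_mem_homogeneousInt (s : Fin (k + 1) →₀ ℕ) (c : ℝ) :
    monomial s c ∈ homogeneousInt k s.degree := by
  rw [← mul_one c, ← smul_eq_mul, ← smul_monomial]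
  exact Submodule.smul_mem _ _ (Submodule.subset_span ⟨s, rfl, rfl⟩)

lemma MvPolynomial.IsHomogeneous.mem_homogeneousInt {p : MvPolynomial (Fin (k + 1)) ℝ} {n : ℕ}
    (hp : p.IsHomogeneous n) : p ∈ homogeneousInt k n := by
  rw [p.as_sum]
  refine Submodule.sum_mem _ fun s hs => ?_
  rw [← hp.degree_eq_of_mem_support hs]
  exact monomial_mem_homogeneousInt _ _

lemma eq_zero_of_mem_homogeneousInt_neg {p : MvPolynomial (Fin (k + 1)) ℝ} {d : ℤ} (hd : d < 0)
    (hp : p ∈ homogeneousInt k d) : p = 0 := by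
  have h : {p : MvPolynomial (Fin (k + 1)) ℝ |
      ∃ s : Fin (k + 1) →₀ ℕ, (s.degree : ℤ) = d ∧ p = monomial s 1} = ∅ := by
    ext p
    simp only [Set.mem_ofPred_eq, Set.mem_empty_iff_false, iff_false]
    rintro ⟨s, hs, -⟩
    omega
  rwa [homogeneousInt, h, Submodule.span_empty, Submodule.mem_bot] at hp

lemma eq_C_of_mem_homogeneousInt_zero {p : MvPolynomial (Fin (k + 1)) ℝ}
    (hp : p ∈ homogeneousInt k 0) : ∃ c, p = C c := by
  induction hp using Submodule.span_induction with
  | mem x hx =>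
    obtain ⟨s, hs, rfl⟩ := hx
    have : s = 0 := by simpa [Finsupp.degree_eq_zero_iff] using hs
    exact ⟨1, by rw [this]; rfl⟩
  | zero => exact ⟨0, by simp⟩
  | add x y _ _ hx hy =>
    obtain ⟨a, rfl⟩ := hx
    obtain ⟨b, rfl⟩ := hy
    exact ⟨a + b, by simp⟩
  | smul a x _ hx =>
    obtain ⟨b, rfl⟩ := hx
    exact ⟨a * b, by simp [smul_eq_C_mul]⟩

lemma dunklOp_mem_homogeneousInt (α : Fin (k + 1) → ℝ) (j : Fin (k + 1)) {d : ℤ}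
    {p : MvPolynomial (Fin (k + 1)) ℝ} (hp : p ∈ homogeneousInt k d) :
    dunklOp α j p ∈ homogeneousInt k (d - 1) := by
  induction hp using Submodule.span_induction with
  | mem x hx =>
    obtain ⟨s, hs, rfl⟩ := hx
    rw [dunklOp_monomial]
    by_cases h : s j = 0
    · simp [h]
    · have hle : Finsupp.single j 1 ≤ s := by simpa [Nat.one_le_iff_ne_zero] using h
      have h2 := congrArg Finsupp.degree (tsub_add_cancel_of_le hle)
      rw [map_add, Finsupp.degree_single] at h2
      have h3 : d - 1 = ((s - Finsupp.single j 1).degree : ℤ) := by omega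
      rw [h3]
      exact monomial_mem_homogeneousInt _ _
  | zero => simp
  | add x y _ _ hx hy => rw [map_add]; exact Submodule.add_mem _ hx hy
  | smul a x _ hx => rw [map_smul]; exact Submodule.smul_mem _ _ hx

lemma dunklLaplacian_mem_homogeneousInt (α : Fin (k + 1) → ℝ) {d : ℤ}
    {p : MvPolynomial (Fin (k + 1)) ℝ} (hp : p ∈ homogeneousInt k d) :
    dunklLaplacian α p ∈ homogeneousInt k (d - 2) := by
  rw [dunklLaplacian_apply]
  refine Submodule.sum_mem _ fun j _ => ?_
  have := dunklOp_mem_homogeneousInt α j (dunklOp_mem_homogeneousInt α j hp)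
  rwa [show d - 1 - 1 = d - 2 by ring] at this

lemma dunklPolyOp_monomial_mem_homogeneousInt (α : Fin (k + 1) → ℝ) (s : Fin (k + 1) →₀ ℕ)
    (c : ℝ) {d : ℤ} {p : MvPolynomial (Fin (k + 1)) ℝ} (hp : p ∈ homogeneousInt k d) :
    dunklPolyOp α (monomial s c) p ∈ homogeneousInt k (d - s.degree) := by
  obtain ⟨n, hn⟩ : ∃ n, s.degree = n := ⟨_, rfl⟩
  induction n generalizing s d p with
  | zero =>
    obtain rfl : s = 0 := (Finsupp.degree_eq_zero_iff s).1 hn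
    rw [← C_apply, dunklPolyOp_C]
    simpa using Submodule.smul_mem _ c hp
  | succ n ih =>
    obtain ⟨i, hi⟩ : ∃ i, s i ≠ 0 := by
      by_contra! h
      rw [(Finsupp.degree_eq_zero_iff s).2 (Finsupp.ext h)] at hn
      omega
    have hle : Finsupp.single i 1 ≤ s := by simpa [Nat.one_le_iff_ne_zero] using hi
    have hs := tsub_add_cancel_of_le hle
    have h2 := congrArg Finsupp.degree hs
    rw [map_add, Finsupp.degree_single] at h2
    have h3 := ih (s - Finsupp.single i 1) (dunklOp_mem_homogeneousInt α i hp) (by omega)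
    rw [← hs, ← mul_one c, ← monomial_mul, ← X, dunklPolyOp_mul_X, Module.End.mul_apply, hs]
    convert h3 using 2
    omega

lemma dunklPolyOp_mem_homogeneousInt (α : Fin (k + 1) → ℝ) {Y : MvPolynomial (Fin (k + 1)) ℝ}
    {m : ℕ} (hY : Y.IsHomogeneous m) {d : ℤ} {p : MvPolynomial (Fin (k + 1)) ℝ}
    (hp : p ∈ homogeneousInt k d) : dunklPolyOp α Y p ∈ homogeneousInt k (d - m) := by
  rw [dunklPolyOp, LinearMap.sum_apply]
  refine Submodule.sum_mem _ fun s hs => ?_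
  rw [← dunklPolyOp_monomial, ← hY.degree_eq_of_mem_support hs]
  exact dunklPolyOp_monomial_mem_homogeneousInt α s _ hp

/-! ### Moments of the weighted Gaussian on the line -/

/-- The `n`th moment `∫ |x|^(2a) x^n e^(-x²/2) dx` of the weighted Gaussian on the line. -/
def gaussMoment (a : ℝ) (n : ℕ) : ℝ :=
  ∫ x : ℝ, (|x| ^ a) ^ 2 * x ^ n * Real.exp (-(x ^ 2) / 2)

lemma gaussMoment_odd (a : ℝ) {n : ℕ} (hn : Odd n) : gaussMoment a n = 0 := by
  have h := integral_neg_eq_self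
    (fun x : ℝ => (|x| ^ a) ^ 2 * x ^ n * Real.exp (-(x ^ 2) / 2)) volume
  simp only [abs_neg, hn.neg_pow, neg_sq, mul_neg, neg_mul, integral_neg] at h
  rw [gaussMoment]
  linarith

lemma rpow_sq_mul_pow_mul_exp {a x : ℝ} (n : ℕ) (hx : 0 < x) :
    (x ^ a) ^ 2 * x ^ n * Real.exp (-(x ^ 2) / 2) =
      x ^ (2 * a + n) * Real.exp (-(1 / 2) * x ^ (2 : ℝ)) := by
  rw [Real.rpow_add hx, mul_comm 2 a, Real.rpow_mul hx.le, Real.rpow_natCast, Real.rpow_two,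
    Real.rpow_two]
  congr 2
  ring

lemma integral_rpow_mul_exp_neg_half_sq {q : ℝ} (hq : -1 < q) :
    ∫ x in Set.Ioi (0 : ℝ), x ^ q * Real.exp (-(1 / 2) * x ^ (2 : ℝ)) =
      2 ^ ((q + 1) / 2 - 1) * Real.Gamma ((q + 1) / 2) := by
  have h : ((1 : ℝ) / 2) ^ (-(q + 1) / 2) = 2 ^ ((q + 1) / 2) := by
    rw [one_div, Real.inv_rpow two_pos.le, ← Real.rpow_neg two_pos.le]
    congr 1; ring
  rw [integral_rpow_mul_exp_neg_mul_rpow two_pos hq one_half_pos, h,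
    Real.rpow_sub_one two_ne_zero]
  ring

lemma gaussMoment_even {a : ℝ} (ha : 0 ≤ a) {n : ℕ} (hn : Even n) :
    gaussMoment a n = 2 ^ (a + (n + 1) / 2) * Real.Gamma (a + (n + 1) / 2) := by
  have h := integral_comp_abs
    (f := fun x : ℝ => (x ^ a) ^ 2 * x ^ n * Real.exp (-(x ^ 2) / 2))
  simp only [hn.pow_abs, sq_abs] at h
  have hq : -1 < 2 * a + n := by
    have : (0 : ℝ) ≤ n := n.cast_nonneg
    linarith
  rw [gaussMoment, h, setIntegral_congr_fun measurableSet_Ioi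
    (fun x hx => rpow_sq_mul_pow_mul_exp n hx), integral_rpow_mul_exp_neg_half_sq hq,
    Real.rpow_sub_one (by norm_num), show (2 * a + n + 1) / 2 = a + (n + 1) / 2 by ring]
  ring

lemma gaussMoment_add_two {a : ℝ} (ha : 0 ≤ a) (n : ℕ) :
    gaussMoment a (n + 2) = dunklNum a (n + 1) * gaussMoment a n := by
  rcases n.even_or_odd with hn | hn
  · have hs : a + ((n : ℝ) + 1) / 2 ≠ 0 := by positivity
    rw [gaussMoment_even ha hn, gaussMoment_even ha (hn.add even_two), dunklNum_odd a hn.add_one]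
    rw [show a + (((n + 2 : ℕ) : ℝ) + 1) / 2 = a + ((n : ℝ) + 1) / 2 + 1 by push_cast; ring,
      Real.Gamma_add_one hs, Real.rpow_add_one (by norm_num)]
    push_cast
    ring
  · rw [gaussMoment_odd a hn, gaussMoment_odd a (hn.add_even even_two), mul_zero]

/-- Integration by parts on the line, for the monomials `x^s` and `x^t`. The truncated exponents
`s - 1` and `t - 1` are harmless because `dunklNum a 0 = 0`. -/
lemma gaussMoment_succ_add {a : ℝ} (ha : 0 ≤ a) (s t : ℕ) :
    gaussMoment a (1 + s + t) = dunklNum a s * gaussMoment a (s - 1 + t) +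
      dunklNum a t * gaussMoment a (s + (t - 1)) := by
  rcases s with _ | s
  · rcases t with _ | t
    · simp [gaussMoment_odd]
    · simp only [dunklNum_zero, zero_mul, zero_add, add_zero, Nat.add_sub_cancel]
      rw [← gaussMoment_add_two ha]
      congr 1; ring
  · rcases t with _ | t
    · simp only [dunklNum_zero, zero_mul, add_zero, Nat.add_sub_cancel]
      rw [← gaussMoment_add_two ha]
      congr 1; ring
    · simp only [Nat.add_sub_cancel]
      rw [show 1 + (s + 1) + (t + 1) = s + (t + 1) + 2 by ring, gaussMoment_add_two ha,
        show s + 1 + t = s + (t + 1) by ring, ← add_mul]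
      by_cases hp : Odd (s + (t + 1))
      · simp [gaussMoment_odd a hp]
      -- `s + t + 2` is odd, so exactly one of the two exponents is odd and contributes `2a`.
      · congr 1
        have hp' : Odd (s + (t + 1) + 1) := (Nat.not_odd_iff_even.1 hp).add_one
        rw [dunklNum_odd a hp']
        rcases (s + 1).even_or_odd with h | h
        · have h' : Odd (t + 1) := by grind
          rw [dunklNum_even a h, dunklNum_odd a h']
          push_cast; ring
        · have h' : Even (t + 1) := by grind
          rw [dunklNum_odd a h, dunklNum_even a h']
          push_cast; ring

lemma dunklNum_mul_gaussMoment (a : ℝ) (n : ℕ) :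
    dunklNum a n * gaussMoment a n = n * gaussMoment a n := by
  rcases n.even_or_odd with h | h
  · rw [dunklNum_even a h]
  · rw [gaussMoment_odd a h, mul_zero, mul_zero]

lemma integrable_gaussMoment {a : ℝ} (ha : 0 ≤ a) (n : ℕ) :
    Integrable fun x : ℝ => (|x| ^ a) ^ 2 * x ^ n * Real.exp (-(x ^ 2) / 2) := by
  have hq : -1 < 2 * a + n := by
    have : (0 : ℝ) ≤ n := n.cast_nonneg
    linarith
  have hc : Continuous fun x : ℝ => |x| ^ a := continuous_abs.rpow_const fun _ => Or.inr ha
  have h : Integrable fun x : ℝ => (‖x‖ ^ a) ^ 2 * ‖x‖ ^ n * Real.exp (-(‖x‖ ^ 2) / 2) := by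
    rw [integrable_fun_norm_addHaar volume
      (f := fun x : ℝ => (x ^ a) ^ 2 * x ^ n * Real.exp (-(x ^ 2) / 2))]
    refine (integrableOn_rpow_mul_exp_neg_mul_rpow hq two_pos one_half_pos).congr_fun
      (fun x hx => ?_) measurableSet_Ioi
    simpa using (rpow_sq_mul_pow_mul_exp n hx).symm
  refine h.mono' (by fun_prop) (ae_of_all _ fun x => le_of_eq ?_)
  rw [norm_mul, norm_mul, norm_pow, norm_pow, Real.norm_of_nonneg (Real.exp_nonneg _),
    Real.norm_of_nonneg (Real.rpow_nonneg (abs_nonneg x) a), Real.norm_eq_abs, sq_abs]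

/-! ### The Gaussian functional -/

/-- The functional `p ↦ ∫ h² p e^(-|x|²/2) dx` on polynomials, defined by
its values on monomials. The integral formula is `gaussFunctional_eq_integral`; the definition
through moments makes linearity immediate and reduces identities to exponents. -/
def gaussFunctional (α : Fin (k + 1) → ℝ) : MvPolynomial (Fin (k + 1)) ℝ →ₗ[ℝ] ℝ :=
  (basisMonomials (Fin (k + 1)) ℝ).constr ℝ fun s => ∏ j, gaussMoment (α j) (s j)

lemma gaussFunctional_monomial (α : Fin (k + 1) → ℝ) (s : Fin (k + 1) →₀ ℕ) (c : ℝ) :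
    gaussFunctional α (monomial s c) = c * ∏ j, gaussMoment (α j) (s j) := by
  have h := (basisMonomials (Fin (k + 1)) ℝ).constr_basis ℝ
    (fun s => ∏ j, gaussMoment (α j) (s j)) s
  rw [coe_basisMonomials] at h
  rw [← mul_one c, ← smul_eq_mul, ← smul_monomial, map_smul, gaussFunctional, h]
  simp

/-- Integration by parts: under the weighted Gaussian the adjoint of `𝒟_j` is `x_j - 𝒟_j`. -/
lemma gaussFunctional_X_mul_mul {α : Fin (k + 1) → ℝ} (hα : ∀ j, 0 ≤ α j) (j : Fin (k + 1))
    (p q : MvPolynomial (Fin (k + 1)) ℝ) :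
    gaussFunctional α (X j * p * q) =
      gaussFunctional α (dunklOp α j p * q) + gaussFunctional α (p * dunklOp α j q) := by
  induction p using MvPolynomial.induction_on' with
  | monomial s c =>
    induction q using MvPolynomial.induction_on' with
    | monomial t d =>
      rw [X, monomial_mul, monomial_mul, dunklOp_monomial, dunklOp_monomial, monomial_mul,
        monomial_mul, gaussFunctional_monomial, gaussFunctional_monomial,
        gaussFunctional_monomial]
      rw [← Finset.mul_prod_erase _ _ (Finset.mem_univ j),
        ← Finset.mul_prod_erase _ (fun i => gaussMoment (α i) ((s - _ + t) i)) (Finset.mem_univ j),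
        ← Finset.mul_prod_erase _ (fun i => gaussMoment (α i) ((s + (t - _)) i))
          (Finset.mem_univ j)]
      have h1 : ∏ i ∈ Finset.univ.erase j,
            gaussMoment (α i) ((Finsupp.single j 1 + s + t : Fin (k + 1) →₀ ℕ) i) =
          ∏ i ∈ Finset.univ.erase j, gaussMoment (α i) (s i + t i) :=
        Finset.prod_congr rfl fun i hi => by
          simp [Finsupp.single_eq_of_ne (Finset.ne_of_mem_erase hi)]
      have h2 : ∏ i ∈ Finset.univ.erase j,
            gaussMoment (α i) ((s - Finsupp.single j 1 + t : Fin (k + 1) →₀ ℕ) i) =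
          ∏ i ∈ Finset.univ.erase j, gaussMoment (α i) (s i + t i) :=
        Finset.prod_congr rfl fun i hi => by
          simp [Finsupp.single_eq_of_ne (Finset.ne_of_mem_erase hi)]
      have h3 : ∏ i ∈ Finset.univ.erase j,
            gaussMoment (α i) ((s + (t - Finsupp.single j 1) : Fin (k + 1) →₀ ℕ) i) =
          ∏ i ∈ Finset.univ.erase j, gaussMoment (α i) (s i + t i) :=
        Finset.prod_congr rfl fun i hi => by
          simp [Finsupp.single_eq_of_ne (Finset.ne_of_mem_erase hi)]
      rw [h1, h2, h3]
      simp only [Finsupp.add_apply, Finsupp.tsub_apply, Finsupp.single_eq_same]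
      rw [gaussMoment_succ_add (hα j)]
      ring
    | add p q hp hq => simp only [mul_add, map_add, hp, hq]; ring
  | add p q hp hq => simp only [mul_add, add_mul, map_add, hp, hq]; ring

/-- Moving `Y(𝒟)` to the other factor of the Gaussian pairing turns `Y` into `e^{-Δ_h/2} Y`,
which every sufficiently long partial sum represents. -/
lemma gaussFunctional_dunklPolyOp {α : Fin (k + 1) → ℝ} (hα : ∀ j, 0 ≤ α j)
    (Y : MvPolynomial (Fin (k + 1)) ℝ) :
    ∀ᶠ N in atTop, ∀ p, gaussFunctional α (dunklPolyOp α Y p) =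
      gaussFunctional α (p * heatSum α N Y) := by
  induction Y using MvPolynomial.induction_on with
  | C c =>
    filter_upwards [eventually_ge_atTop 1] with N hN p
    obtain ⟨N, rfl⟩ := Nat.exists_eq_succ_of_ne_zero (by omega : N ≠ 0)
    have hC : dunklLaplacian α (C c) = 0 := by
      rw [dunklLaplacian_apply]
      exact Finset.sum_eq_zero fun j _ => by
        rw [C_apply, dunklOp_monomial]; simp
    rw [Nat.succ_eq_add_one, heatSum_of_harmonic α N hC, dunklPolyOp_C, mul_comm, ← smul_eq_C_mul]
    rfl
  | add Y Z hY hZ =>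
    filter_upwards [hY, hZ] with N h1 h2 p
    rw [dunklPolyOp_add, LinearMap.add_apply, map_add, h1, h2, map_add, mul_add, map_add]
  | mul_X Y i hY =>
    obtain ⟨N₀, h⟩ := eventually_atTop.1 hY
    filter_upwards [eventually_ge_atTop (N₀ + 1)] with N hN p
    obtain ⟨N, rfl⟩ := Nat.exists_eq_succ_of_ne_zero (by omega : N ≠ 0)
    have h1 := h (N + 1) (by omega) (X i * p)
    have h2 := h N (by omega)
    -- The induction hypothesis is used at `x_i p` with `N + 1` terms, and at both `x_i p` and
    -- `𝒟_i p` with `N` terms, so the commutation relation for the partial sums applies as is.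
    have h3 := gaussFunctional_X_mul_mul hα i p (heatSum α N Y)
    rw [← h2, ← h2] at h3
    rw [dunklPolyOp_mul_X, Module.End.mul_apply, Nat.succ_eq_add_one, mul_comm Y,
      heatSum_X_mul, mul_sub, map_sub, ← mul_assoc, mul_comm p, ← h1]
    linarith

/-- For an `h`-harmonic `Y` the operator `e^{-Δ_h/2}` fixes `Y`, so `Y(𝒟)` is adjoint to
multiplication by `Y`. -/
lemma gaussFunctional_mul_of_harmonic {α : Fin (k + 1) → ℝ} (hα : ∀ j, 0 ≤ α j)
    {Y : MvPolynomial (Fin (k + 1)) ℝ} (hY : dunklLaplacian α Y = 0)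
    (p : MvPolynomial (Fin (k + 1)) ℝ) :
    gaussFunctional α (p * Y) = gaussFunctional α (dunklPolyOp α Y p) := by
  obtain ⟨N, h⟩ := eventually_atTop.1 (gaussFunctional_dunklPolyOp hα Y)
  rw [h (N + 1) (by omega), heatSum_of_harmonic α N hY]

/-- Euler's relation under the Gaussian functional: `∑ x_j 𝒟_j` differs from the Euler operator
only by terms that are odd in some coordinate, and those have integral zero. -/
lemma gaussFunctional_dunklLaplacian {α : Fin (k + 1) → ℝ} (hα : ∀ j, 0 ≤ α j) {d : ℤ}
    {p : MvPolynomial (Fin (k + 1)) ℝ} (hp : p ∈ homogeneousInt k d) :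
    gaussFunctional α (dunklLaplacian α p) = d * gaussFunctional α p := by
  -- Integration by parts against the constant `1`.
  have key : ∀ p, gaussFunctional α (dunklLaplacian α p) =
      ∑ j, gaussFunctional α (X j * dunklOp α j p) := by
    intro p
    rw [dunklLaplacian_apply, map_sum]
    refine Finset.sum_congr rfl fun j _ => ?_
    have h1 : dunklOp α j 1 = 0 := by
      rw [← C_1, C_apply, dunklOp_monomial]; simp
    have h := gaussFunctional_X_mul_mul hα j (dunklOp α j p) 1
    rw [h1, mul_one, mul_one, mul_zero, map_zero, add_zero] at h
    exact h.symm
  rw [key]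
  induction hp using Submodule.span_induction with
  | mem x hx =>
    obtain ⟨s, hs, rfl⟩ := hx
    have h : ∀ j, gaussFunctional α (X j * dunklOp α j (monomial s 1)) =
        (s j : ℝ) * gaussFunctional α (monomial s 1) := by
      intro j
      rw [X_mul_dunklOp_monomial, gaussFunctional_monomial, gaussFunctional_monomial,
        ← Finset.mul_prod_erase _ _ (Finset.mem_univ j)]
      linear_combination (∏ i ∈ Finset.univ.erase j, gaussMoment (α i) (s i)) *
        dunklNum_mul_gaussMoment (α j) (s j)
    simp_rw [h]
    rw [← Finset.sum_mul, ← hs, Finsupp.degree_eq_sum]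
    push_cast
    rfl
  | zero => simp
  | add x y _ _ hx hy => simp only [map_add, mul_add, Finset.sum_add_distrib, hx, hy]
  | smul a x _ hx =>
    simp only [map_smul, mul_smul_comm, smul_eq_mul, ← Finset.mul_sum, hx]; ring

lemma gaussFunctional_odd {α : Fin (k + 1) → ℝ} (hα : ∀ j, 0 ≤ α j) {d : ℤ} (hd : Odd d)
    {p : MvPolynomial (Fin (k + 1)) ℝ} (hp : p ∈ homogeneousInt k d) :
    gaussFunctional α p = 0 := by
  by_cases hneg : d < 0
  · rw [eq_zero_of_mem_homogeneousInt_neg hneg hp, map_zero]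
  obtain ⟨r, rfl⟩ := hd
  obtain ⟨r, rfl⟩ := Int.eq_ofNat_of_zero_le (by omega : 0 ≤ r)
  clear hneg
  induction r generalizing p with
  | zero =>
    have h := gaussFunctional_dunklLaplacian hα hp
    rw [eq_zero_of_mem_homogeneousInt_neg (by norm_num) (dunklLaplacian_mem_homogeneousInt α hp)]
      at h
    simpa using h.symm
  | succ r ih =>
    have h := gaussFunctional_dunklLaplacian hα hp
    have hm := dunklLaplacian_mem_homogeneousInt α hp
    rw [ih (by convert hm using 2; push_cast; ring)] at h
    have : (((2 * ((r + 1 : ℕ) : ℤ) + 1 : ℤ)) : ℝ) ≠ 0 := by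
      push_cast; positivity
    exact (mul_eq_zero.1 h.symm).resolve_left this

lemma gaussFunctional_even {α : Fin (k + 1) → ℝ} (hα : ∀ j, 0 ≤ α j) (r : ℕ)
    {p : MvPolynomial (Fin (k + 1)) ℝ} (hp : p ∈ homogeneousInt k (2 * r))
    (z : Fin (k + 1) → ℝ) :
    gaussFunctional α p =
      eval z ((dunklLaplacian α ^ r) p) / (2 ^ r * r.factorial) * gaussFunctional α 1 := by
  induction r generalizing p with
  | zero =>
    obtain ⟨c, rfl⟩ := eq_C_of_mem_homogeneousInt_zero (by simpa using hp)
    rw [← mul_one (C c), ← smul_eq_C_mul]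
    simp
  | succ r ih =>
    have h := gaussFunctional_dunklLaplacian hα hp
    have hm := dunklLaplacian_mem_homogeneousInt α hp
    rw [ih (by convert hm using 2; push_cast; ring), ← Module.End.mul_apply, ← pow_succ] at h
    rw [Nat.factorial_succ]
    push_cast at h ⊢
    field_simp at h ⊢
    linear_combination -h

lemma gaussFunctional_one {α : Fin (k + 1) → ℝ} (hα : ∀ j, 0 ≤ α j) :
    gaussFunctional α 1 = 2 ^ (dunklMu α + 1) * ∏ j, Real.Gamma (α j + 1 / 2) := by
  rw [← C_1, C_apply, gaussFunctional_monomial, one_mul]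
  simp only [Finsupp.coe_zero, Pi.zero_apply, gaussMoment_even (hα _) Even.zero, Nat.cast_zero,
    zero_add]
  rw [Finset.prod_mul_distrib, ← Real.rpow_sum_of_pos two_pos]
  congr 2
  rw [Finset.sum_add_distrib, dunklMu]
  simp
  ring

/-! ### Polar coordinates -/

/-- Integration in polar coordinates of a function that separates into an angular and a radial
factor. -/
lemma integral_eq_toSphere_mul_of_separated {E : Type*} [NormedAddCommGroup E] [NormedSpace ℝ E]
    [FiniteDimensional ℝ E] [MeasurableSpace E] [BorelSpace E] [Nontrivial E] (ν : Measure E)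
    [ν.IsAddHaarMeasure] {H : E → ℝ} (G : Metric.sphere (0 : E) 1 → ℝ) (f : ℝ → ℝ)
    (hH : ∀ (ω : Metric.sphere (0 : E) 1) (r : ℝ), 0 < r → H (r • ω.1) = G ω * f r) :
    ∫ x, H x ∂ν = (∫ ω, G ω ∂ν.toSphere) *
      ∫ y in Set.Ioi (0 : ℝ), y ^ (Module.finrank ℝ E - 1) * f y :=
  calc
    ∫ x, H x ∂ν = ∫ x : ({(0)}ᶜ : Set E), H x.1 ∂(ν.comap (↑)) := by
      rw [integral_subtype_comap (measurableSet_singleton _).compl fun x ↦ H x,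
        restrict_compl_singleton]
    _ = ∫ x : ({(0)}ᶜ : Set E), G (homeomorphUnitSphereProd E x).1 *
          f (homeomorphUnitSphereProd E x).2.1 ∂(ν.comap (↑)) := by
      refine integral_congr_ae (ae_of_all _ fun x => ?_)
      have h := hH (homeomorphUnitSphereProd E x).1 (homeomorphUnitSphereProd E x).2.1
        (homeomorphUnitSphereProd E x).2.2
      have hx : ‖x.1‖ ≠ 0 := norm_ne_zero_iff.2 x.2
      simp only [homeomorphUnitSphereProd_apply_fst_coe,
        homeomorphUnitSphereProd_apply_snd_coe, smul_smul, mul_inv_cancel₀ hx, one_smul] at h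
      simpa only [homeomorphUnitSphereProd_apply_snd_coe] using h
    _ = ∫ x, G x.1 * f x.2.1 ∂ν.toSphere.prod (.volumeIoiPow (Module.finrank ℝ E - 1)) :=
      ν.measurePreserving_homeomorphUnitSphereProd.integral_comp
        (Homeomorph.measurableEmbedding _)
        (fun x : Metric.sphere (0 : E) 1 × Set.Ioi (0 : ℝ) => G x.1 * f x.2.1)
    _ = (∫ ω, G ω ∂ν.toSphere) *
          ∫ x : Set.Ioi (0 : ℝ), f x ∂.volumeIoiPow (Module.finrank ℝ E - 1) :=
      integral_prod_mul G fun x : Set.Ioi (0 : ℝ) => f x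
    _ = _ := by
      congr 1
      simp only [Measure.volumeIoiPow, ENNReal.ofReal]
      rw [integral_withDensity_eq_integral_smul, integral_subtype_comap measurableSet_Ioi
          fun a ↦ Real.toNNReal (a ^ (Module.finrank ℝ E - 1)) • f a,
        setIntegral_congr_fun measurableSet_Ioi fun x hx ↦ ?_]
      · rw [NNReal.smul_def, Real.coe_toNNReal _ (pow_nonneg hx.out.le _), smul_eq_mul]
      · exact (measurable_subtype_coe.pow_const _).real_toNNReal

lemma gaussian_integrand_monomial (α : Fin (k + 1) → ℝ) (s : Fin (k + 1) →₀ ℕ) (c : ℝ)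
    (x : EuclideanSpace ℝ (Fin (k + 1))) :
    dunklWeight α x ^ 2 * eval x.ofLp (monomial s c) * Real.exp (-‖x‖ ^ 2 / 2) =
      c * ∏ j, ((|x j| ^ α j) ^ 2 * x j ^ s j * Real.exp (-(x j ^ 2) / 2)) := by
  rw [Finset.prod_mul_distrib, Finset.prod_mul_distrib, Finset.prod_pow, ← Real.exp_sum,
    ← Finset.sum_div, Finset.sum_neg_distrib, EuclideanSpace.norm_sq_eq, eval_monomial,
    Finsupp.prod_fintype _ _ (by simp), dunklWeight]
  simp only [Real.norm_eq_abs, sq_abs]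
  ring

lemma integrable_gaussian (α : Fin (k + 1) → ℝ) (hα : ∀ j, 0 ≤ α j)
    (p : MvPolynomial (Fin (k + 1)) ℝ) :
    Integrable fun x : EuclideanSpace ℝ (Fin (k + 1)) =>
      dunklWeight α x ^ 2 * eval x.ofLp p * Real.exp (-‖x‖ ^ 2 / 2) := by
  induction p using MvPolynomial.induction_on' with
  | monomial s c =>
    simp_rw [gaussian_integrand_monomial]
    have h := Integrable.fintype_prod (μ := fun _ => (volume : Measure ℝ))
      fun j => integrable_gaussMoment (hα j) (s j)
    exact ((PiLp.volume_preserving_ofLp (Fin (k + 1))).integrable_comp_of_integrable h).const_mul c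
  | add p q hp hq =>
    simp only [map_add, mul_add, add_mul]
    exact hp.add hq

lemma gaussFunctional_eq_integral (α : Fin (k + 1) → ℝ) (hα : ∀ j, 0 ≤ α j)
    (p : MvPolynomial (Fin (k + 1)) ℝ) :
    gaussFunctional α p = ∫ x : EuclideanSpace ℝ (Fin (k + 1)),
      dunklWeight α x ^ 2 * eval x.ofLp p * Real.exp (-‖x‖ ^ 2 / 2) := by
  induction p using MvPolynomial.induction_on' with
  | monomial s c =>
    simp_rw [gaussian_integrand_monomial]
    rw [integral_const_mul, gaussFunctional_monomial]
    congr 1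
    have h := (EuclideanSpace.volume_preserving_symm_measurableEquiv_toLp
      (Fin (k + 1))).integral_comp' (fun x : Fin (k + 1) → ℝ =>
        ∏ j, ((|x j| ^ α j) ^ 2 * x j ^ s j * Real.exp (-(x j ^ 2) / 2)))
    refine Eq.trans ?_ h.symm
    exact (integral_fintype_prod_volume_eq_prod
      fun j (x : ℝ) => (|x| ^ α j) ^ 2 * x ^ s j * Real.exp (-(x ^ 2) / 2)).symm
  | add p q hp hq =>
    rw [map_add, hp, hq,
      ← integral_add (integrable_gaussian α hα p) (integrable_gaussian α hα q)]
    simp only [map_add, mul_add, add_mul]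

lemma dunklWeight_smul (α : Fin (k + 1) → ℝ) {r : ℝ} (hr : 0 < r)
    (x : EuclideanSpace ℝ (Fin (k + 1))) :
    dunklWeight α (r • x) = r ^ (∑ j, α j) * dunklWeight α x := by
  simp only [dunklWeight, PiLp.smul_apply, smul_eq_mul, abs_mul, abs_of_pos hr]
  rw [Real.rpow_sum_of_pos hr, ← Finset.prod_mul_distrib]
  exact Finset.prod_congr rfl fun j _ => Real.mul_rpow hr.le (abs_nonneg _)

lemma MvPolynomial.IsHomogeneous.eval_smul_eq {σ R : Type*} [CommSemiring R]
    {p : MvPolynomial σ R} {d : ℕ} (hp : p.IsHomogeneous d) (r : R) (x : σ → R) :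
    eval (r • x) p = r ^ d * eval x p := by
  rw [eval_eq, eval_eq, Finset.mul_sum]
  refine Finset.sum_congr rfl fun s hs => ?_
  simp only [Pi.smul_apply, smul_eq_mul, mul_pow]
  rw [Finset.prod_mul_distrib, Finset.prod_pow_eq_pow_sum, ← hp.degree_eq_of_mem_support hs,
    Finsupp.degree_apply]
  ring

/-- Integration in polar coordinates relates the Gaussian functional to the sphere. -/
lemma gaussFunctional_eq_toSphere (α : Fin (k + 1) → ℝ) (hα : ∀ j, 0 ≤ α j) {d : ℕ}
    {p : MvPolynomial (Fin (k + 1)) ℝ} (hp : p.IsHomogeneous d) :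
    gaussFunctional α p =
      (∫ x : Metric.sphere (0 : EuclideanSpace ℝ (Fin (k + 1))) 1,
        dunklWeight α x.1 ^ 2 * eval x.1.ofLp p
          ∂(volume : Measure (EuclideanSpace ℝ (Fin (k + 1)))).toSphere) *
      (2 ^ (dunklMu α + d / 2) * Real.Gamma (dunklMu α + d / 2 + 1)) := by
  -- The exponent of the radial integral `∫ r^q e^(-r²/2) dr`.
  set q : ℝ := k + 2 * (∑ j, α j) + d with hq
  have hq1 : -1 < q := by
    have := Finset.sum_nonneg fun j (_ : j ∈ Finset.univ) => hα j
    have h1 : (0 : ℝ) ≤ k := k.cast_nonneg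
    have h2 : (0 : ℝ) ≤ d := d.cast_nonneg
    linarith
  have hqs : (q + 1) / 2 = dunklMu α + d / 2 + 1 := by
    rw [hq, dunklMu]; ring
  rw [gaussFunctional_eq_integral α hα, integral_eq_toSphere_mul_of_separated volume
    (fun ω : Metric.sphere (0 : EuclideanSpace ℝ (Fin (k + 1))) 1 =>
      dunklWeight α ω.1 ^ 2 * eval ω.1.ofLp p)
    (fun r => (r ^ (∑ j, α j)) ^ 2 * r ^ d * Real.exp (-r ^ 2 / 2))]
  · congr 1
    rw [finrank_euclideanSpace_fin, Nat.add_sub_cancel,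
      show dunklMu α + (d : ℝ) / 2 = (q + 1) / 2 - 1 by rw [hqs]; ring, sub_add_cancel,
      ← integral_rpow_mul_exp_neg_half_sq hq1]
    refine setIntegral_congr_fun measurableSet_Ioi fun r hr => ?_
    have hr : 0 < r := hr
    rw [rpow_sq_mul_pow_mul_exp d hr, ← mul_assoc, ← Real.rpow_natCast r k, ← Real.rpow_add hr,
      hq, add_assoc]
  · intro ω r hr
    have hnorm : ‖ω.1‖ = 1 := mem_sphere_zero_iff_norm.1 ω.2
    rw [dunklWeight_smul α hr, norm_smul, hnorm, mul_one, Real.norm_of_nonneg hr.le,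
      WithLp.ofLp_smul, hp.eval_smul_eq]
    ring

/-! ### Integrals over the sphere against an `h`-harmonic -/

lemma dunklMu_nonneg {α : Fin (k + 1) → ℝ} (hk : 1 ≤ k) (hα : ∀ j, 0 ≤ α j) :
    0 ≤ dunklMu α := by
  have h1 := Finset.sum_nonneg fun j (_ : j ∈ Finset.univ) => hα j
  have h2 : (1 : ℝ) ≤ k := by exact_mod_cast hk
  rw [dunklMu]
  linarith

/-- The spherical integral of `h² p Y`, up to an explicit nonzero factor, is the Gaussian
functional of `Y(𝒟) p`. -/
lemma toSphere_integral_mul_harmonic (α : Fin (k + 1) → ℝ) (hα : ∀ j, 0 ≤ α j)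
    {l m : ℕ} {p Y : MvPolynomial (Fin (k + 1)) ℝ} (hp : p.IsHomogeneous l)
    (hY : IsSphericalHHarmonic α m Y) :
    (∫ x : Metric.sphere (0 : EuclideanSpace ℝ (Fin (k + 1))) 1,
        dunklWeight α x.1 ^ 2 * eval x.1.ofLp p * eval x.1.ofLp Y
          ∂(volume : Measure (EuclideanSpace ℝ (Fin (k + 1)))).toSphere) *
      (2 ^ (dunklMu α + (l + m) / 2) * Real.Gamma (dunklMu α + (l + m) / 2 + 1)) =
      gaussFunctional α (dunklPolyOp α Y p) := by
  rw [← gaussFunctional_mul_of_harmonic hα hY.dunklLaplacian_eq_zero,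
    gaussFunctional_eq_toSphere α hα (hp.mul hY.isHomogeneous)]
  simp only [map_mul, ← mul_assoc, Nat.cast_add]

/-- Here `Y(𝒟) p` has negative degree, hence vanishes, or has odd degree. -/
lemma toSphere_integral_mul_harmonic_eq_zero (hk : 1 ≤ k) (α : Fin (k + 1) → ℝ)
    (hα : ∀ j, 0 ≤ α j) {l m : ℕ} {p Y : MvPolynomial (Fin (k + 1)) ℝ} (hp : p.IsHomogeneous l)
    (hY : IsSphericalHHarmonic α m Y) (hlm : l < m ∨ Odd ((l : ℤ) - m)) :
    ∫ x : Metric.sphere (0 : EuclideanSpace ℝ (Fin (k + 1))) 1,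
        dunklWeight α x.1 ^ 2 * eval x.1.ofLp p * eval x.1.ofLp Y
          ∂(volume : Measure (EuclideanSpace ℝ (Fin (k + 1)))).toSphere = 0 := by
  have h := toSphere_integral_mul_harmonic α hα hp hY
  have hmem := dunklPolyOp_mem_homogeneousInt α hY.isHomogeneous hp.mem_homogeneousInt
  have hz : gaussFunctional α (dunklPolyOp α Y p) = 0 := by
    rcases hlm with hlm | hlm
    · rw [eq_zero_of_mem_homogeneousInt_neg (by omega) hmem, map_zero]
    · exact gaussFunctional_odd hα hlm hmem
  rw [hz] at h
  have hμ := dunklMu_nonneg hk hα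
  have hΓ : 0 < Real.Gamma (dunklMu α + ((l : ℝ) + m) / 2 + 1) :=
    Real.Gamma_pos_of_pos (by positivity)
  exact (mul_eq_zero.1 h).resolve_right (by positivity)

/-- The formula of the theorem for a single homogeneous polynomial. -/
lemma toSphere_integral_mul_harmonic_eq (hk : 1 ≤ k) (α : Fin (k + 1) → ℝ)
    (hα : ∀ j, 0 ≤ α j) {r m : ℕ} {p Y : MvPolynomial (Fin (k + 1)) ℝ}
    (hp : p.IsHomogeneous (m + 2 * r)) (hY : IsSphericalHHarmonic α m Y)
    (z : Fin (k + 1) → ℝ) :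
    ∫ x : Metric.sphere (0 : EuclideanSpace ℝ (Fin (k + 1))) 1,
        dunklWeight α x.1 ^ 2 * eval x.1.ofLp p * eval x.1.ofLp Y
          ∂(volume : Measure (EuclideanSpace ℝ (Fin (k + 1)))).toSphere =
      1 / ((2 : ℝ) ^ ((m : ℤ) + 2 * (r : ℤ) - 1) * (r.factorial : ℝ)) *
        ((∏ i, Real.Gamma (α i + 1 / 2)) / Real.Gamma ((m : ℝ) + dunklMu α + r + 1)) *
        eval z ((dunklLaplacian α ^ r) (dunklPolyOp α Y p)) := by
  have h := toSphere_integral_mul_harmonic α hα hp hY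
  have hmem := dunklPolyOp_mem_homogeneousInt α hY.isHomogeneous hp.mem_homogeneousInt
  rw [gaussFunctional_even hα r (by convert hmem using 2; push_cast; ring) z,
    gaussFunctional_one hα] at h
  have hμ := dunklMu_nonneg hk hα
  have hs : dunklMu α + (((m + 2 * r : ℕ) : ℝ) + m) / 2 = m + dunklMu α + r := by
    push_cast; ring
  have hΓ : 0 < Real.Gamma ((m : ℝ) + dunklMu α + r + 1) :=
    Real.Gamma_pos_of_pos (by positivity)
  rw [hs] at h
  have h2 : (2 : ℝ) ^ ((m : ℝ) + dunklMu α + r) * 2 ^ r =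
      2 ^ (dunklMu α + 1) * (2 : ℝ) ^ ((m : ℤ) + 2 * (r : ℤ) - 1) := by
    rw [← Real.rpow_natCast, ← Real.rpow_intCast, ← Real.rpow_add two_pos,
      ← Real.rpow_add two_pos]
    congr 1
    push_cast; ring
  have hz : (0 : ℝ) < (2 : ℝ) ^ ((m : ℤ) + 2 * (r : ℤ) - 1) := by positivity
  have hz1 : (0 : ℝ) < 2 ^ (dunklMu α + 1) := by positivity
  have hz2 : (0 : ℝ) < 2 ^ ((m : ℝ) + dunklMu α + r) := by positivity
  have hf : (0 : ℝ) < r.factorial := by positivity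
  have hr : (0 : ℝ) < 2 ^ r := by positivity
  generalize (∫ x : Metric.sphere (0 : EuclideanSpace ℝ (Fin (k + 1))) 1,
        dunklWeight α x.1 ^ 2 * eval x.1.ofLp p * eval x.1.ofLp Y
          ∂(volume : Measure (EuclideanSpace ℝ (Fin (k + 1)))).toSphere) = I at h ⊢
  generalize (2 : ℝ) ^ ((m : ℤ) + 2 * (r : ℤ) - 1) = a at *
  generalize (2 : ℝ) ^ (dunklMu α + 1) = b at *
  generalize (2 : ℝ) ^ ((m : ℝ) + dunklMu α + r) = c at *
  generalize (2 : ℝ) ^ r = d at *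
  generalize Real.Gamma ((m : ℝ) + dunklMu α + r + 1) = g at *
  generalize (r.factorial : ℝ) = e at *
  generalize eval z ((dunklLaplacian α ^ r) (dunklPolyOp α Y p)) = t at *
  generalize ∏ i, Real.Gamma (α i + 1 / 2) = q at *
  have h3 : I * c * g * (d * e) = t * b * q := by
    field_simp at h
    linear_combination h
  have h4 : b * (I * a * g * e) = b * (t * q) := by
    linear_combination h3 - I * g * e * h2
  have h5 := mul_left_cancel₀ hz1.ne' h4
  field_simp
  linear_combination h5

/-! ### Passage to the uniform limit -/

lemma continuous_dunklWeight (α : Fin (k + 1) → ℝ) (hα : ∀ j, 0 ≤ α j) :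
    Continuous (dunklWeight α) := by
  unfold dunklWeight
  refine continuous_finsetProd _ fun j _ => ?_
  exact (continuous_abs.comp (by fun_prop)).rpow_const fun _ => Or.inr (hα j)

/-- Over a compact space of finite measure, uniform convergence of continuous functions passes
through multiplication by a continuous function and integration. -/
lemma integrable_and_tendsto_integral_of_tendstoUniformly {X : Type*} [TopologicalSpace X]
    [CompactSpace X] [MeasurableSpace X] [BorelSpace X] [SecondCountableTopology X]
    (ν : Measure X) [IsFiniteMeasure ν]
    {S : ℕ → X → ℝ} {f w : X → ℝ} (hS : ∀ N, Continuous (S N)) (hw : Continuous w)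
    (hf : TendstoUniformly S f atTop) :
    Integrable (fun x => w x * f x) ν ∧
      Tendsto (fun N => ∫ x, w x * S N x ∂ν) atTop (𝓝 (∫ x, w x * f x ∂ν)) := by
  have hfc : Continuous f := hf.continuous (Eventually.of_forall hS).frequently
  have hint : ∀ {g : X → ℝ}, Continuous g → Integrable g ν := fun hg =>
    hg.integrable_of_hasCompactSupport (HasCompactSupport.of_compactSpace _)
  refine ⟨hint (hw.mul hfc), ?_⟩
  refine tendsto_integral_filter_of_dominated_convergence
    (fun x => |w x| * (|f x| + 1)) (Eventually.of_forall fun N => ?_) ?_ ?_ ?_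
  · exact (hint (hw.mul (hS N))).aestronglyMeasurable
  · filter_upwards [Metric.tendstoUniformly_iff.1 hf 1 one_pos] with N hN
    refine ae_of_all _ fun x => ?_
    rw [Real.norm_eq_abs, abs_mul]
    have h1 := hN x
    rw [dist_comm, Real.dist_eq] at h1
    have h2 := abs_sub_abs_le_abs_sub (S N x) (f x)
    exact mul_le_mul_of_nonneg_left (by linarith) (abs_nonneg _)
  · exact hint (by fun_prop)
  · exact ae_of_all _ fun x => (hf.tendsto_at x).const_mul _

end

theorem corollary4p2 (k : ℕ) (hk : 1 ≤ k) (α : Fin (k + 1) → ℝ) (hα : ∀ j, 0 ≤ α j)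
    (hμ : ¬ (k = 1 ∧ ∀ j, α j = 0))
    (F : ℕ → MvPolynomial (Fin (k + 1)) ℝ) (hF : ∀ l, (F l).IsHomogeneous l)
    (f : EuclideanSpace ℝ (Fin (k + 1)) → ℝ)
    (hf : TendstoUniformlyOn
      (fun (N : ℕ) (x : EuclideanSpace ℝ (Fin (k + 1))) =>
        ∑ l ∈ Finset.range N, MvPolynomial.eval x.ofLp (F l))
      f atTop (Metric.sphere 0 1))
    (m : ℕ) (Y : MvPolynomial (Fin (k + 1)) ℝ) (hY : IsSphericalHHarmonic α m Y) :
    Integrable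
      (fun x : Metric.sphere (0 : EuclideanSpace ℝ (Fin (k + 1))) 1 =>
        dunklWeight α x.1 ^ 2 * f x.1 * MvPolynomial.eval x.1.ofLp Y)
      (volume : Measure (EuclideanSpace ℝ (Fin (k + 1)))).toSphere ∧
    ∀ z : Fin (k + 1) → ℝ,
      Tendsto
        (fun N : ℕ => ∑ r ∈ Finset.range N,
          1 / ((2 : ℝ) ^ ((m : ℤ) + 2 * (r : ℤ) - 1) * (r.factorial : ℝ)) *
            ((∏ i, Real.Gamma (α i + 1 / 2)) / Real.Gamma ((m : ℝ) + dunklMu α + r + 1)) *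
            MvPolynomial.eval z ((dunklLaplacian α ^ r) (dunklPolyOp α Y (F (m + 2 * r)))))
        atTop
        (𝓝 (∫ x : Metric.sphere (0 : EuclideanSpace ℝ (Fin (k + 1))) 1,
          dunklWeight α x.1 ^ 2 * f x.1 * MvPolynomial.eval x.1.ofLp Y
            ∂(volume : Measure (EuclideanSpace ℝ (Fin (k + 1)))).toSphere)) := by
  set ν := (volume : Measure (EuclideanSpace ℝ (Fin (k + 1)))).toSphere with hν
  have hev : ∀ p : MvPolynomial (Fin (k + 1)) ℝ,
      Continuous fun x : Metric.sphere (0 : EuclideanSpace ℝ (Fin (k + 1))) 1 =>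
        eval x.1.ofLp p := fun p =>
    (MvPolynomial.continuous_eval p).comp
      ((PiLp.continuous_ofLp 2 _).comp continuous_subtype_val)
  have hw : Continuous fun x : Metric.sphere (0 : EuclideanSpace ℝ (Fin (k + 1))) 1 =>
      dunklWeight α x.1 ^ 2 * eval x.1.ofLp Y :=
    (((continuous_dunklWeight α hα).comp continuous_subtype_val).pow 2).mul (hev Y)
  have hS : ∀ N, Continuous fun x : Metric.sphere (0 : EuclideanSpace ℝ (Fin (k + 1))) 1 =>
      ∑ l ∈ Finset.range N, eval x.1.ofLp (F l) := fun N =>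
    continuous_finsetSum _ fun l _ => hev (F l)
  obtain ⟨hint, hlim⟩ := integrable_and_tendsto_integral_of_tendstoUniformly ν hS hw
    (tendstoUniformlyOn_iff_tendstoUniformly_comp_coe.1 hf)
  have hcomm : ∀ g : EuclideanSpace ℝ (Fin (k + 1)) → ℝ,
      (fun x : Metric.sphere (0 : EuclideanSpace ℝ (Fin (k + 1))) 1 =>
        dunklWeight α x.1 ^ 2 * g x.1 * eval x.1.ofLp Y) =
      fun x => dunklWeight α x.1 ^ 2 * eval x.1.ofLp Y * g x.1 :=
    fun g => funext fun x => by ring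
  rw [hcomm f]
  refine ⟨hint, fun z => ?_⟩
  -- The first `N` terms of the series are the first `m + 2N` terms of `∑ f_l`, integrated: the
  -- terms with `l < m` or `l - m` odd contribute zero.
  have hsub : Tendsto (fun N : ℕ => m + 2 * N) atTop atTop :=
    tendsto_atTop_mono (fun N => show N ≤ m + 2 * N by omega) tendsto_id
  refine (hlim.comp hsub).congr fun N => ?_
  have hI : ∀ l, Integrable (fun x : Metric.sphere (0 : EuclideanSpace ℝ (Fin (k + 1))) 1 =>
      dunklWeight α x.1 ^ 2 * eval x.1.ofLp Y * eval x.1.ofLp (F l)) ν := fun l =>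
    (hw.mul (hev (F l))).integrable_of_hasCompactSupport (HasCompactSupport.of_compactSpace _)
  simp only [Function.comp_apply, Finset.mul_sum]
  rw [integral_finsetSum _ fun l _ => hI l]
  have hzero : ∀ l, (l < m ∨ Odd ((l : ℤ) - m)) →
      ∫ x : Metric.sphere (0 : EuclideanSpace ℝ (Fin (k + 1))) 1,
        dunklWeight α x.1 ^ 2 * eval x.1.ofLp Y * eval x.1.ofLp (F l) ∂ν = 0 := by
    intro l hl
    rw [← hcomm fun x => eval x.ofLp (F l)]
    exact toSphere_integral_mul_harmonic_eq_zero hk α hα (hF l) hY hl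
  induction N with
  | zero =>
    exact Finset.sum_eq_zero fun l hl => hzero l (Or.inl (by simpa using hl))
  | succ N ih =>
    rw [show m + 2 * (N + 1) = m + 2 * N + 1 + 1 by ring, Finset.sum_range_succ,
      Finset.sum_range_succ, ih, Finset.sum_range_succ,
      hzero (m + 2 * N + 1) (Or.inr ⟨N, by push_cast; ring⟩), add_zero,
      ← toSphere_integral_mul_harmonic_eq hk α hα (hF (m + 2 * N)) hY z,
      ← hcomm fun x => eval x.ofLp (F (m + 2 * N))]
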